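/- Call an expression over the variables $x_1,\dots,x_d$ and $n$ a \emph{normalized poly-exponential expression} over $\vec x=(x_1,\dots,x_d)$ if it has the form $\sum_{j=1}^{\ell}\alpha_j\cdot n^{a_j}\cdot b_j^{\,n}$, where $\ell,a_j\in\mathbb N$, $b_j\in\mathbb N$ with $b_j\ge 1$, and each $\alpha_j$ is an affine expression $q_1x_1+\dots+q_dx_d+q_0$ with coefficients $q_0,\dots,q_d\in\mathbb Q$. Write $p[\vec x/\vec c]$ for the result of substituting $\vec c\in\mathbb Z^d$ for $\vec x$ in $p$. \textbf{Lemma (Deciding Eventual Positiveness).} Validity of $$\exists\,\vec c\in\mathbb Z^d,\ n_0\in\mathbb N.\ \forall n\in\mathbb N,\ n>n_0.\ \bigwedge_{i=1}^{k}p_i[\vec x/\vec c]>0,$$ where $p_1,\dots,p_k$ are normalized poly-exponential expressions over $\vec x$, is decidable. That is, there is a single algorithm which, for all $d,k\in\mathbb N$ and all such $p_1,\dots,p_k$ (given as finite data: $d$ and the lists of coefficients, exponents and bases, rational numbers being written as integer fractions), terminates and determines whether the formula is valid. -/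

import Mathlib

namespace PolyExp

/-- Affine expressions with rational coefficients over the variables `x₁, …, x_d`. -/
structure AffineExpr (d : ℕ) where
  coeff : Fin d → ℚ
  const : ℚ

/-- The value of an affine expression after substituting `x` by the integer vector `c`. -/
def AffineExpr.eval {d : ℕ} (α : AffineExpr d) (c : Fin d → ℤ) : ℚ :=
  (∑ i, α.coeff i * (c i : ℚ)) + α.const

/-- An addend `coeff * n ^ exp * base ^ n` with `exp ∈ ℕ` and `base ∈ ℕ`, `base ≥ 1`. -/
structure Addend (d : ℕ) where
  coeff : AffineExpr d
  exp : ℕ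
  base : ℕ+

/-- The value of an addend for `x = c` and a given `n`. -/
def Addend.eval {d : ℕ} (t : Addend d) (c : Fin d → ℤ) (n : ℕ) : ℚ :=
  t.coeff.eval c * (n : ℚ) ^ t.exp * (t.base : ℚ) ^ n

/-- Normalized poly-exponential expressions over `x₁, …, x_d`: finite (possibly empty) sums
of addends. Neither distinctness of the pairs `(base, exp)` nor non-vanishing of the
coefficients is imposed. -/
structure NPE (d : ℕ) where
  addends : List (Addend d)

/-- The value of `p` for `x = c` and a given `n`. -/
def NPE.eval {d : ℕ} (p : NPE d) (c : Fin d → ℤ) (n : ℕ) : ℚ :=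
  (p.addends.map fun t => t.eval c n).sum

/-- The validity of `∃ c ∈ ℤ^d, n₀ ∈ ℕ. ∀ n > n₀. ⋀ᵢ pᵢ[x/c] > 0`. -/
def EventuallyPositive {d k : ℕ} (p : Fin k → NPE d) : Prop :=
  ∃ (c : Fin d → ℤ) (n₀ : ℕ), ∀ n : ℕ, n₀ < n → ∀ i, 0 < (p i).eval c n

/-! The finite data by which an instance is presented to an algorithm: a rational number is
written as its reduced numerator and denominator, a vector as the list of its entries, and a sum
as the list of its addends. -/

/-- Numerator and denominator. -/
abbrev RatCode : Type := ℤ × ℕ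

/-- The list of the variables' coefficients, and the constant. -/
abbrev AffineCode : Type := List RatCode × RatCode

/-- The coefficient, the exponent and the base. -/
abbrev AddendCode : Type := AffineCode × ℕ × ℕ

/-- The list of addends. -/
abbrev NPECode : Type := List AddendCode

/-- The dimension `d` and the list of the expressions `p₁, …, p_k`. -/
abbrev InstanceCode : Type := ℕ × List NPECode

def ratCode (q : ℚ) : RatCode := (q.num, q.den)

def AffineExpr.code {d : ℕ} (α : AffineExpr d) : AffineCode :=
  (List.ofFn fun i => ratCode (α.coeff i), ratCode α.const)

def Addend.code {d : ℕ} (t : Addend d) : AddendCode :=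
  (t.coeff.code, t.exp, (t.base : ℕ))

def NPE.code {d : ℕ} (p : NPE d) : NPECode :=
  p.addends.map Addend.code

def instanceCode {d k : ℕ} (p : Fin k → NPE d) : InstanceCode :=
  (d, List.ofFn fun i => (p i).code)

end PolyExp

/-! For fixed `c`, clear denominators and collect the addends of an expression by their pair (base,
exponent). The functions `n ^ a * b ^ n` are ordered by growth as the pairs `(b, a)` are
lexicographically, so for large `n` the sign is that of the nonvanishing coefficient with the
largest pair (`sum_growth_pos_iff`). Eventual positiveness of all expressions therefore says that,
for some choice of a leading pair in each, the leading coefficient is positive at `c` and all larger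
ones vanish: a finite disjunction of integer linear systems in `c`.

Two explicit bounds turn this into a finite search. A solvable integer system has a solution bounded
in terms of the number of variables and the size of the coefficients (`exists_small_solution`). For
`c` in that box, the sign is already final at an explicit `n`. Hence it suffices to test every `c`
in the box at that single `n` (`eventuallyPositive_iff_bounded`). All bounds and evaluations are
primitive recursive, and the code number of the instance serves as its size. -/

namespace PolyExp

/-! ### Small solutions of integer linear inequalities -/

open Finset

/-- The value of the integral affine form with linear part `r.1` and constant part `r.2`. -/
def formEval {d : ℕ} (x : Fin d → ℤ) (r : (Fin d → ℤ) × ℤ) : ℤ :=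
  ∑ j, r.1 j * x j + r.2

/-- The growth of the size of a linear system when one variable is eliminated. -/
def elimGrowth (M : ℕ) : ℕ := 6 * M ^ 4

theorem id_le_elimGrowth : id ≤ elimGrowth := fun M => by
  rcases Nat.eq_zero_or_pos M with rfl | h
  · simp
  · have : M ^ 1 ≤ M ^ 4 := Nat.pow_le_pow_right h (by norm_num)
    rw [pow_one] at this
    simp only [id, elimGrowth]
    omega

theorem le_elimGrowth_iterate (k M : ℕ) : M ≤ elimGrowth^[k] M :=
  Function.id_le_iterate_of_id_le id_le_elimGrowth k M

theorem abs_sum_le_card_mul {d : ℕ} {f : Fin d → ℤ} {K : ℤ} (h : ∀ i, |f i| ≤ K) :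
    |∑ i, f i| ≤ d * K := by
  refine (abs_sum_le_sum_abs _ _).trans ((sum_le_card_nsmul _ _ K fun i _ => h i).trans ?_)
  simp

theorem abs_mul_le_mul {a b A B : ℤ} (ha : |a| ≤ A) (hb : |b| ≤ B) : |a * b| ≤ A * B := by
  rw [abs_mul]
  exact mul_le_mul ha hb (abs_nonneg _) ((abs_nonneg _).trans ha)

theorem exists_minimal_solution {d : ℕ} {R : Set ((Fin d → ℤ) × ℤ)}
    (h : ∃ x, ∀ r ∈ R, 0 ≤ formEval x r) :
    ∃ x, (∀ r ∈ R, 0 ≤ formEval x r) ∧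
      ∀ x', (∀ r ∈ R, 0 ≤ formEval x' r) → ∑ j, (x j).natAbs ≤ ∑ j, (x' j).natAbs := by
  obtain ⟨x, hx, hmin⟩ := (measure fun x : Fin d → ℤ => ∑ j, (x j).natAbs).wf.has_min
    {x | ∀ r ∈ R, 0 ≤ formEval x r} h
  exact ⟨x, hx, fun x' hx' => not_lt.1 (hmin x' hx')⟩

theorem formEval_update_sub {d : ℕ} (x : Fin d → ℤ) (j : Fin d) (v : ℤ)
    (r : (Fin d → ℤ) × ℤ) :
    formEval (Function.update x j (x j - v)) r = formEval x r - r.1 j * v := by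
  have : ∀ i, r.1 i * Function.update x j (x j - v) i
      = r.1 i * x i - (if i = j then r.1 j * v else 0) := by
    intro i
    by_cases hi : i = j
    · subst hi; simp; ring
    · simp [hi]
  simp only [formEval, this, sum_sub_distrib, sum_ite_eq', mem_univ, if_true]
  ring

/-- A solution of minimal norm is zero or almost attains one of the constraints. -/
theorem exists_nearly_tight {d : ℕ} {R : Set ((Fin d → ℤ) × ℤ)} {x : Fin d → ℤ}
    (hx : ∀ r ∈ R, 0 ≤ formEval x r)
    (hmin : ∀ x', (∀ r ∈ R, 0 ≤ formEval x' r) → ∑ j, (x j).natAbs ≤ ∑ j, (x' j).natAbs)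
    {j : Fin d} (hj : x j ≠ 0) :
    ∃ r ∈ R, r.1 j ≠ 0 ∧ formEval x r < |r.1 j| := by
  by_contra! hcon
  -- Moving `x j` one unit towards zero lowers the norm and each form by at most `|r.1 j|`; if every
  -- slack were that large, minimality would fail.
  have hs : ∑ i, (Function.update x j (x j - (x j).sign) i).natAbs < ∑ i, (x i).natAbs := by
    refine sum_lt_sum (fun i _ => ?_) ⟨j, mem_univ _, ?_⟩
    · by_cases hi : i = j
      · subst hi
        rw [Function.update_self]
        rcases lt_or_gt_of_ne hj with h | h
        · rw [Int.sign_eq_neg_one_of_neg h]; omega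
        · rw [Int.sign_eq_one_of_pos h]; omega
      · simp [hi]
    · rw [Function.update_self]
      rcases lt_or_gt_of_ne hj with h | h
      · rw [Int.sign_eq_neg_one_of_neg h]; omega
      · rw [Int.sign_eq_one_of_pos h]; omega
  refine absurd (hmin _ fun r hr => ?_) (not_le.2 hs)
  rw [formEval_update_sub]
  by_cases h0 : r.1 j = 0
  · simpa [h0] using hx r hr
  · have h1 := hcon r hr h0
    have h2 : r.1 j * (x j).sign ≤ |r.1 j| := by
      refine (le_abs_self _).trans ?_
      rw [abs_mul, Int.abs_sign_of_ne_zero hj, mul_one]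
    linarith

/-- The substitution expressing a vector through the quotients `y` modulo `m`, with remainders `r`,
of its entries other than the `j`-th, the latter being `u - ∑ l, s * a l * y l`. -/
def elimLift {d : ℕ} (j : Fin (d + 1)) (m s u : ℤ) (a r y : Fin d → ℤ) : Fin (d + 1) → ℤ :=
  j.insertNth (u - ∑ l, s * a l * y l) fun l => m * y l + r l

/-- The affine form resulting from a form by the substitution `elimLift`. -/
def elimForm {d : ℕ} (j : Fin (d + 1)) (m s u : ℤ) (a r : Fin d → ℤ)
    (ρ : (Fin (d + 1) → ℤ) × ℤ) : (Fin d → ℤ) × ℤ :=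
  (fun l => ρ.1 (j.succAbove l) * m - ρ.1 j * (s * a l),
    ρ.2 + ρ.1 j * u + ∑ l, ρ.1 (j.succAbove l) * r l)

theorem formEval_elimForm {d : ℕ} (j : Fin (d + 1)) (m s u : ℤ) (a r y : Fin d → ℤ)
    (ρ : (Fin (d + 1) → ℤ) × ℤ) :
    formEval y (elimForm j m s u a r ρ) = formEval (elimLift j m s u a r y) ρ := by
  simp only [formEval, elimForm, elimLift, Fin.sum_univ_succAbove _ j, Fin.insertNth_apply_same,
    Fin.insertNth_apply_succAbove, sub_mul, mul_add, mul_sub, sum_add_distrib, sum_sub_distrib,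
    mul_sum]
  have h1 : ∀ l, ρ.1 j * (s * a l) * y l = ρ.1 j * (s * a l * y l) := fun l => by ring
  have h2 : ∀ l, ρ.1 (j.succAbove l) * m * y l = ρ.1 (j.succAbove l) * (m * y l) :=
    fun l => by ring
  simp only [h1, h2]
  ring

/-- Divide the other entries by `|A|` with remainder. As `A * A.sign = |A|`, the quotient part of `∑
a l * x l` is a multiple of `A` and is absorbed into `u`. What is left of `A * u` involves only the
value of the linear part and small remainders, so a nearly tight constraint bounds `u`. -/
theorem elimLift_ediv_emod {d : ℕ} (j : Fin (d + 1)) (A : ℤ) (a x) :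
    ∃ u, A * u = A * x j + ∑ l, a l * x (j.succAbove l) - ∑ l, a l * (x (j.succAbove l) % |A|) ∧
      elimLift j |A| A.sign u a (fun l => x (j.succAbove l) % |A|)
        (fun l => x (j.succAbove l) / |A|) = x := by
  refine ⟨x j + ∑ l, A.sign * a l * (x (j.succAbove l) / |A|), ?_, ?_⟩
  · have : ∀ l, a l * x (j.succAbove l) = A * (A.sign * a l * (x (j.succAbove l) / |A|))
        + a l * (x (j.succAbove l) % |A|) := by
      intro l
      conv_lhs => rw [← Int.mul_ediv_add_emod (x (j.succAbove l)) |A|]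
      have h : A * A.sign = |A| := Int.mul_sign_self A ▸ (Int.abs_eq_natAbs A).symm
      rw [mul_add, ← h]
      ring
    simp only [this, sum_add_distrib, ← mul_sum]
    ring
  · ext i
    refine Fin.succAboveCases j ?_ (fun l => ?_) i
    · simp [elimLift]
    · simp only [elimLift, Fin.insertNth_apply_succAbove]
      exact Int.mul_ediv_add_emod _ _

/-- Induction on the number of variables: a nearly tight constraint of a minimal solution allows one
variable to be eliminated over ℤ. Each elimination costs two applications of `elimGrowth`, one for
the coefficients of the new system and one for lifting its solution. The number of constraints plays
no role, so `R` may be any set; `d ≤ M` lets sums over the variables be absorbed into powers of `M`.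
-/
theorem exists_small_solution (d : ℕ) : ∀ (M : ℕ), d ≤ M → 1 ≤ M →
    ∀ R : Set ((Fin d → ℤ) × ℤ), (∀ r ∈ R, (∀ j, |r.1 j| ≤ M) ∧ |r.2| ≤ M) →
    (∃ x : Fin d → ℤ, ∀ r ∈ R, 0 ≤ formEval x r) →
    ∃ x : Fin d → ℤ, (∀ j, |x j| ≤ ((elimGrowth^[2 * d] M : ℕ) : ℤ)) ∧ ∀ r ∈ R, 0 ≤ formEval x r := by
  induction d with
  | zero =>
    rintro M - - R - ⟨x, hx⟩
    exact ⟨x, fun j => j.elim0, hx⟩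
  | succ d ih =>
    intro M hdM hM R hR hsol
    obtain ⟨x, hx, hmin⟩ := exists_minimal_solution hsol
    by_cases h0 : ∀ j, x j = 0
    · exact ⟨x, fun j => by simp [h0 j], hx⟩
    push Not at h0
    obtain ⟨j, hj⟩ := h0
    obtain ⟨ρ₀, hρ₀, hA, htight⟩ := exists_nearly_tight hx hmin hj
    obtain ⟨u, hu, hlift⟩ := elimLift_ediv_emod j (ρ₀.1 j) (fun l => ρ₀.1 (j.succAbove l)) x
    set A := ρ₀.1 j with hAdef
    set a : Fin d → ℤ := fun l => ρ₀.1 (j.succAbove l) with ha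
    set r : Fin d → ℤ := fun l => x (j.succAbove l) % |A| with hr
    have hM' : (1 : ℤ) ≤ M := by exact_mod_cast hM
    have hdM' : (d : ℤ) ≤ M := by exact_mod_cast (Nat.le_succ d).trans hdM
    have hAM : |A| ≤ M := (hR _ hρ₀).1 j
    have hA0 : 0 < |A| := abs_pos.2 hA
    have haM : ∀ l, |a l| ≤ M := fun l => (hR _ hρ₀).1 _
    have hrM : ∀ l, |r l| ≤ M := fun l => by
      rw [abs_of_nonneg (Int.emod_nonneg _ hA0.ne')]
      exact (Int.emod_lt_of_pos _ hA0).le.trans hAM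
    have hsign : |A.sign| ≤ 1 := (Int.abs_sign_of_ne_zero hA).le
    have hdot : ∀ ρ : Fin d → ℤ, (∀ l, |ρ l| ≤ M) → |∑ l, ρ l * r l| ≤ (M : ℤ) ^ 3 := by
      intro ρ hρ
      refine (abs_sum_le_card_mul fun l => abs_mul_le_mul (hρ l) (hrM l)).trans ?_
      nlinarith [mul_le_mul_of_nonneg_right hdM' (mul_nonneg (by positivity : (0 : ℤ) ≤ M)
        (by positivity : (0 : ℤ) ≤ M))]
    -- Slack and constant term contribute at most `M` each, the remainders `M ^ 3`; then divide by
    -- `|A| ≥ 1`.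
    have huM : |u| ≤ 2 * M + (M : ℤ) ^ 3 := by
      have h1 : formEval x ρ₀ = A * x j + ∑ l, a l * x (j.succAbove l) + ρ₀.2 := by
        simp [formEval, Fin.sum_univ_succAbove _ j, ha, hAdef]
      have h2 : |A * u| ≤ 2 * M + (M : ℤ) ^ 3 := by
        have h3 := abs_le.1 (hdot a haM)
        have h4 := hx _ hρ₀
        have h5 := abs_le.1 (hR _ hρ₀).2
        rw [abs_le, hu]
        constructor <;> linarith [h3.1, h3.2, h5.1, h5.2]
      rw [abs_mul] at h2
      nlinarith [abs_nonneg u]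
    -- The new constants are at most `M + M * (2 * M + M ^ 3) + M ^ 3`, which is below `6 * M ^ 4`.
    have hg : ((elimGrowth M : ℕ) : ℤ) = 6 * (M : ℤ) ^ 4 := by simp [elimGrowth]
    have p12 : (M : ℤ) ≤ (M : ℤ) ^ 2 := by nlinarith
    have p23 : (M : ℤ) ^ 2 ≤ (M : ℤ) ^ 3 := by
      nlinarith [mul_le_mul_of_nonneg_right hM' (sq_nonneg (M : ℤ))]
    have p34 : (M : ℤ) ^ 3 ≤ (M : ℤ) ^ 4 := by
      nlinarith [mul_le_mul_of_nonneg_right hM' (pow_nonneg (zero_le_one.trans hM') 3)]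
    obtain ⟨y, hyB, hy⟩ := ih (elimGrowth M)
      ((Nat.le_succ d).trans (hdM.trans (id_le_elimGrowth M))) (hM.trans (id_le_elimGrowth M))
      (elimForm j |A| A.sign u a r '' R) (by
        rintro _ ⟨ρ, hρ, rfl⟩
        obtain ⟨hρ1, hρ2⟩ := hR ρ hρ
        rw [hg]
        constructor
        · intro l
          have h1 := abs_mul_le_mul (hρ1 (j.succAbove l)) ((abs_abs A).le.trans hAM)
          have h2 := abs_mul_le_mul (hρ1 j) (abs_mul_le_mul hsign (haM l))
          refine (abs_sub _ _).trans ?_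
          nlinarith
        · have h1 := abs_mul_le_mul (hρ1 j) huM
          have h2 := hdot _ fun l => hρ1 (j.succAbove l)
          refine (abs_add_le _ _).trans ((add_le_add_left (abs_add_le _ _) _).trans ?_)
          nlinarith)
      ⟨fun l => x (j.succAbove l) / |A|, by
        rintro _ ⟨ρ, hρ, rfl⟩
        rw [formEval_elimForm, hlift]
        exact hx ρ hρ⟩
    refine ⟨elimLift j |A| A.sign u a r y, ?_, fun ρ hρ => ?_⟩
    · have hMY := (id_le_elimGrowth M).trans (le_elimGrowth_iterate (2 * d) (elimGrowth M))
      rw [show 2 * (d + 1) = (2 * d + 1) + 1 by ring, Function.iterate_succ_apply',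
        Function.iterate_succ_apply]
      generalize elimGrowth^[2 * d] (elimGrowth M) = Y at hyB hMY
      have hMY' : (M : ℤ) ≤ Y := by exact_mod_cast hMY
      have hY1 : (1 : ℤ) ≤ Y := hM'.trans hMY'
      have hg' : ((elimGrowth Y : ℕ) : ℤ) = 6 * (Y : ℤ) ^ 4 := by simp [elimGrowth]
      have q12 : (Y : ℤ) ≤ (Y : ℤ) ^ 2 := by nlinarith
      have q23 : (Y : ℤ) ^ 2 ≤ (Y : ℤ) ^ 3 := by
        nlinarith [mul_le_mul_of_nonneg_right hY1 (sq_nonneg (Y : ℤ))]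
      have q34 : (Y : ℤ) ^ 3 ≤ (Y : ℤ) ^ 4 := by
        nlinarith [mul_le_mul_of_nonneg_right hY1 (pow_nonneg (zero_le_one.trans hY1) 3)]
      have hcube : (M : ℤ) ^ 3 ≤ (Y : ℤ) ^ 3 := by gcongr
      rw [hg']
      intro i
      refine Fin.succAboveCases j ?_ (fun l => ?_) i
      · have h1 : |∑ l, A.sign * a l * y l| ≤ (Y : ℤ) ^ 3 := by
          refine (abs_sum_le_card_mul fun l =>
            abs_mul_le_mul (abs_mul_le_mul hsign (haM l)) (hyB l)).trans ?_
          calc (d : ℤ) * (1 * M * Y) ≤ Y * (1 * Y * Y) := by gcongr; exact_mod_cast hdM'.trans hMY'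
            _ = (Y : ℤ) ^ 3 := by ring
        simp only [elimLift, Fin.insertNth_apply_same]
        refine (abs_sub _ _).trans ?_
        linarith
      · simp only [elimLift, Fin.insertNth_apply_succAbove]
        have h1 := abs_mul_le_mul ((abs_abs A).le.trans hAM) (hyB l)
        have h2 := hrM l
        refine (abs_add_le _ _).trans ?_
        nlinarith
    · rw [← formEval_elimForm]
      exact hy _ ⟨ρ, hρ, rfl⟩

end PolyExp

/-! ### Comparison of growth and the final sign of a sum -/

namespace PolyExp

open Finset

/-- The function `n ↦ n ^ a * b ^ n` for `x = (b, a)`. -/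
def growth (x : ℕ ×ₗ ℕ) (n : ℕ) : ℕ := n ^ (ofLex x).2 * (ofLex x).1 ^ n

/-- Bernoulli's inequality for `(1 + 1 / b) ^ m`, without fractions. -/
theorem pow_mul_succ_le {b : ℕ} (hb : 1 ≤ b) (m : ℕ) : b ^ m * (m + 1) ≤ b * (b + 1) ^ m := by
  induction m with
  | zero => simpa using hb
  | succ m ih =>
    have h : b ^ m ≤ (b + 1) ^ m := Nat.pow_le_pow_left (Nat.le_succ b) m
    calc b ^ (m + 1) * (m + 1 + 1) = b * (b ^ m * (m + 1)) + b * b ^ m := by ring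
      _ ≤ b * (b * (b + 1) ^ m) + b * (b + 1) ^ m := by gcongr
      _ = b * (b + 1) ^ (m + 1) := by ring

/-- With `n = e * m + r`, the `e`-th power of the Bernoulli bound for `m` gives an explicit
constant. -/
theorem pow_mul_pow_le {b : ℕ} (hb : 1 ≤ b) (n e : ℕ) (he : 0 < e) :
    n ^ e * b ^ n ≤ (e * b) ^ e * (b + 1) ^ n := by
  set m := n / e
  set r := n % e
  have hn : n = e * m + r := (Nat.div_add_mod n e).symm
  have hle : n ≤ e * (m + 1) := by
    have := Nat.mod_lt n he
    rw [mul_add, mul_one]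
    omega
  calc n ^ e * b ^ n = n ^ e * b ^ (e * m + r) := by rw [← hn]
    _ ≤ (e * (m + 1)) ^ e * b ^ (e * m + r) := by gcongr
    _ = (b ^ m * (m + 1)) ^ e * (e ^ e * b ^ r) := by
      rw [pow_add, mul_comm e m, pow_mul, mul_pow, mul_pow]; ring
    _ ≤ (b * (b + 1) ^ m) ^ e * (e ^ e * (b + 1) ^ r) := by
      exact Nat.mul_le_mul (Nat.pow_le_pow_left (pow_mul_succ_le hb m) e)
        (Nat.mul_le_mul_left _ (Nat.pow_le_pow_left (Nat.le_succ b) r))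
    _ = (e * b) ^ e * (b + 1) ^ (e * m + r) := by
      rw [pow_add, mul_comm e m, pow_mul, mul_pow, mul_pow]; ring
    _ = (e * b) ^ e * (b + 1) ^ n := by rw [← hn]

/-- For a larger base, the previous bound with exponent `a + 1` leaves a spare factor `n` that beats
all constants. For equal bases, the larger exponent itself supplies the factor `n > C`. -/
theorem mul_growth_lt_growth {x y : ℕ ×ₗ ℕ} (hxy : x < y) {s C n : ℕ} (hx1 : 1 ≤ (ofLex x).1)
    (hxs : (ofLex x).1 ≤ s) (hxs' : (ofLex x).2 ≤ s) (hn : C * ((s + 1) * s) ^ (s + 1) < n) :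
    C * growth x n < growth y n := by
  obtain ⟨⟨b, a⟩, rfl⟩ := toLex.surjective x
  obtain ⟨⟨b', a'⟩, rfl⟩ := toLex.surjective y
  simp only [growth, ofLex_toLex] at *
  have hn0 : 0 < n := (Nat.zero_le _).trans_lt hn
  have hs : 1 ≤ s := hx1.trans hxs
  rcases Prod.Lex.toLex_lt_toLex.1 hxy with h | ⟨h, h'⟩
  · simp only at h
    have h1 : C * ((a + 1) * b) ^ (a + 1) < n := by
      refine lt_of_le_of_lt (Nat.mul_le_mul_left _ ?_) hn
      calc ((a + 1) * b) ^ (a + 1) ≤ ((s + 1) * s) ^ (a + 1) := by gcongr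
        _ ≤ ((s + 1) * s) ^ (s + 1) := Nat.pow_le_pow_right (by positivity) (by omega)
    have h2 := pow_mul_pow_le hx1 n (a + 1) (Nat.succ_pos a)
    have h3 : C * (n ^ a * b ^ n) < (b + 1) ^ n := by
      have hpos : 0 < n ^ a * b ^ n := by positivity
      refine lt_of_mul_lt_mul_left (lt_of_lt_of_le ?_ h2) (Nat.zero_le _)
      calc ((a + 1) * b) ^ (a + 1) * (C * (n ^ a * b ^ n))
          = (C * ((a + 1) * b) ^ (a + 1)) * (n ^ a * b ^ n) := by ring
        _ < n * (n ^ a * b ^ n) := Nat.mul_lt_mul_of_pos_right h1 hpos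
        _ = n ^ (a + 1) * b ^ n := by ring
    calc C * (n ^ a * b ^ n) < (b + 1) ^ n := h3
      _ ≤ b' ^ n := Nat.pow_le_pow_left h n
      _ ≤ n ^ a' * b' ^ n := Nat.le_mul_of_pos_left _ (by positivity)
  · simp only at h h'
    subst h
    have h1 : C < n := lt_of_le_of_lt (Nat.le_mul_of_pos_right _ (by positivity)) hn
    calc C * (n ^ a * b ^ n) < n * (n ^ a * b ^ n) :=
          Nat.mul_lt_mul_of_pos_right h1 (by positivity)
      _ = n ^ (a + 1) * b ^ n := by ring
      _ ≤ n ^ a' * b ^ n := by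
        gcongr
        · exact h'

theorem sum_growth_pos {T : Finset (ℕ ×ₗ ℕ)} {β : ℕ ×ₗ ℕ → ℤ} {s K n : ℕ}
    (hT : ∀ x ∈ T, 1 ≤ (ofLex x).1 ∧ (ofLex x).1 ≤ s ∧ (ofLex x).2 ≤ s) (hcard : T.card ≤ s)
    (hβ : ∀ x ∈ T, |β x| ≤ K) (hn : s * K * ((s + 1) * s) ^ (s + 1) < n)
    {x₀ : ℕ ×ₗ ℕ} (hx₀ : x₀ ∈ T) (hpos : 0 < β x₀) (hmax : ∀ x ∈ T, x₀ < x → β x = 0) :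
    0 < ∑ x ∈ T, β x * (growth x n : ℤ) := by
  have hn0 : 0 < n := (Nat.zero_le _).trans_lt hn
  have hw : (0 : ℤ) < growth x₀ n := by
    have := (hT _ hx₀).1
    simp only [growth]
    positivity
  -- Each of the at most `s - 1` other terms can cost only a fraction `1 / s` of the leading growth,
  -- and the integer `β x₀` is at least 1.
  have hle : ∀ x ∈ T.erase x₀, -(growth x₀ n : ℤ) ≤ s * (β x * growth x n) := by
    intro x hx
    obtain ⟨hne, hxT⟩ := mem_erase.1 hx
    rcases lt_or_gt_of_ne hne with h | h
    · obtain ⟨h1, h2, h3⟩ := hT x hxT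
      have h4 : ((s * K * growth x n : ℕ) : ℤ) < growth x₀ n := by
        exact_mod_cast mul_growth_lt_growth h h1 h2 h3 hn
      have h5 : -(K : ℤ) * (s * growth x n) ≤ β x * (s * growth x n) :=
        mul_le_mul_of_nonneg_right (abs_le.1 (hβ x hxT)).1 (by positivity)
      push_cast at h4
      linarith
    · rw [hmax x hxT h]
      simp
  have hsum := card_nsmul_le_sum _ _ _ hle
  rw [card_erase_of_mem hx₀, ← mul_sum, nsmul_eq_mul] at hsum
  rw [← add_sum_erase T _ hx₀]
  have hc : 1 ≤ T.card := card_pos.2 ⟨_, hx₀⟩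
  have hc' : ((T.card - 1 : ℕ) : ℤ) ≤ s - 1 := by omega
  have h1 := mul_le_mul_of_nonneg_right hc' hw.le
  have h2 : (s : ℤ) * growth x₀ n ≤ s * (β x₀ * growth x₀ n) := by
    refine mul_le_mul_of_nonneg_left ?_ (by positivity)
    nlinarith
  refine pos_of_mul_pos_right (a := (s : ℤ)) ?_ (by positivity)
  rw [mul_add]
  linarith

theorem sum_growth_pos_iff {T : Finset (ℕ ×ₗ ℕ)} {β : ℕ ×ₗ ℕ → ℤ} {s K n : ℕ}
    (hT : ∀ x ∈ T, 1 ≤ (ofLex x).1 ∧ (ofLex x).1 ≤ s ∧ (ofLex x).2 ≤ s) (hcard : T.card ≤ s)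
    (hβ : ∀ x ∈ T, |β x| ≤ K) (hn : s * K * ((s + 1) * s) ^ (s + 1) < n) :
    0 < ∑ x ∈ T, β x * (growth x n : ℤ) ↔
      ∃ x₀ ∈ T, 0 < β x₀ ∧ ∀ x ∈ T, x₀ < x → β x = 0 := by
  refine ⟨fun h => ?_, fun ⟨x₀, hx₀, hpos, hmax⟩ => sum_growth_pos hT hcard hβ hn hx₀ hpos hmax⟩
  have hne : (T.filter fun x => β x ≠ 0).Nonempty := by
    by_contra hemp
    rw [not_nonempty_iff_eq_empty, filter_eq_empty_iff] at hemp
    refine h.ne' (sum_eq_zero fun x hx => ?_)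
    rw [not_not.1 (hemp hx), zero_mul]
  obtain ⟨x₀, hx₀, hmax⟩ := exists_max_image _ id hne
  rw [mem_filter] at hx₀
  have hmax' : ∀ x ∈ T, x₀ < x → β x = 0 := fun x hx hlt => by
    by_contra h0
    exact absurd (hmax x (mem_filter.2 ⟨hx, h0⟩)) (not_le.2 hlt)
  refine ⟨x₀, hx₀.1, ?_, hmax'⟩
  by_contra hneg
  -- A negative leading coefficient would make the sum negative, by the same lemma for `-β`.
  have := sum_growth_pos (β := fun x => -β x) hT hcard (fun x hx => by simpa using hβ x hx) hn
    hx₀.1 (neg_pos.2 (lt_of_le_of_ne (not_lt.1 hneg) hx₀.2))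
    (fun x hx hlt => by simp [hmax' x hx hlt])
  simp only [neg_mul, sum_neg_distrib] at this
  linarith

theorem sum_sum_filter_eq {ι κ M : Type*} [DecidableEq κ] [AddCommMonoid M] (key : ι → κ)
    (f : ι → M) (l : List ι) (T : Finset κ) (hT : ∀ t ∈ l, key t ∈ T) :
    ∑ x ∈ T, ((l.filter fun t => key t = x).map f).sum = (l.map f).sum := by
  induction l with
  | nil => simp
  | cons t l ih =>
    have h : ∀ x, (((t :: l).filter fun t => key t = x).map f).sum
        = (if key t = x then f t else 0) + ((l.filter fun t => key t = x).map f).sum := by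
      intro x
      by_cases hx : key t = x <;> simp [hx]
    simp only [h, sum_add_distrib, List.map_cons, List.sum_cons,
      ih fun t ht => hT t (List.mem_cons_of_mem _ ht)]
    simp [hT t List.mem_cons_self]

/-! ### Integral coefficient forms of an expression -/

/-- The numerator of `q` over the denominator `s!`. -/
def scaled (s : ℕ) (q : RatCode) : ℤ := q.1 * ((s.factorial / q.2 : ℕ) : ℤ)

theorem scaled_eq {s : ℕ} {q : ℚ} (h : q.den ≤ s) :
    (scaled s (ratCode q) : ℚ) = s.factorial * q := by
  have hd : q.den ∣ s.factorial := Nat.dvd_factorial q.den_pos h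
  have h0 : (q.den : ℚ) ≠ 0 := by exact_mod_cast q.den_nz
  simp only [scaled, ratCode, Int.cast_mul, Int.cast_natCast, Nat.cast_div hd h0]
  conv_rhs => rw [← Rat.num_div_den q]
  field_simp

theorem abs_scaled_le {s : ℕ} {q : ℚ} (h : |q.num| ≤ s) :
    |scaled s (ratCode q)| ≤ ((s * s.factorial : ℕ) : ℤ) := by
  push_cast
  refine abs_mul_le_mul h ?_
  rw [Nat.abs_cast]
  exact_mod_cast Nat.div_le_self _ _

/-- The integral affine form obtained from `α` by scaling with `s!`. -/
def AffineExpr.form {d : ℕ} (s : ℕ) (α : AffineExpr d) : (Fin d → ℤ) × ℤ :=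
  (fun i => scaled s (ratCode (α.coeff i)), scaled s (ratCode α.const))

/-- The base and the exponent of an addend. -/
def Addend.key {d : ℕ} (t : Addend d) : ℕ ×ₗ ℕ := toLex ((t.base : ℕ), t.exp)

/-- The scaled coefficient of `growth x` in `p`, an integral affine form. -/
def NPE.form {d : ℕ} (s : ℕ) (p : NPE d) (x : ℕ ×ₗ ℕ) : (Fin d → ℤ) × ℤ :=
  ((p.addends.filter fun t => t.key = x).map fun t => t.coeff.form s).sum

/-- The pairs of a base and an exponent that occur in `p`. -/
def NPE.keys {d : ℕ} (p : NPE d) : Finset (ℕ ×ₗ ℕ) := (p.addends.map Addend.key).toFinset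

/-- The numerator and the denominator of `q` are at most `s`. -/
def RatBoundedBy (s : ℕ) (q : ℚ) : Prop := |q.num| ≤ s ∧ q.den ≤ s

/-- All numbers that occur in `p`, and the number of addends, are at most `s`. -/
def NPE.BoundedBy {d : ℕ} (p : NPE d) (s : ℕ) : Prop :=
  p.addends.length ≤ s ∧ ∀ t ∈ p.addends, (t.base : ℕ) ≤ s ∧ t.exp ≤ s ∧
    (∀ i, RatBoundedBy s (t.coeff.coeff i)) ∧ RatBoundedBy s t.coeff.const

theorem formEval_zero {d : ℕ} (c : Fin d → ℤ) : formEval c 0 = 0 := by simp [formEval]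

theorem formEval_add {d : ℕ} (c : Fin d → ℤ) (r r' : (Fin d → ℤ) × ℤ) :
    formEval c (r + r') = formEval c r + formEval c r' := by
  simp only [formEval, Prod.fst_add, Prod.snd_add, Pi.add_apply, add_mul, sum_add_distrib]
  ring

theorem formEval_neg {d : ℕ} (c : Fin d → ℤ) (r : (Fin d → ℤ) × ℤ) :
    formEval c (-r) = -formEval c r := by
  simp only [formEval, Prod.fst_neg, Prod.snd_neg, Pi.neg_apply, neg_mul, sum_neg_distrib]
  ring

theorem formEval_list_sum {d : ℕ} (c : Fin d → ℤ) (l : List ((Fin d → ℤ) × ℤ)) :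
    formEval c l.sum = (l.map (formEval c)).sum := by
  induction l with
  | nil => simp [formEval_zero]
  | cons r l ih => simp [formEval_add, ih]

theorem formEval_form {d s : ℕ} {α : AffineExpr d} (h : ∀ i, RatBoundedBy s (α.coeff i))
    (h' : RatBoundedBy s α.const) (c : Fin d → ℤ) :
    (formEval c (α.form s) : ℚ) = s.factorial * α.eval c := by
  simp only [formEval, AffineExpr.form, AffineExpr.eval, Int.cast_add, Int.cast_sum, Int.cast_mul,
    scaled_eq (h _).2, scaled_eq h'.2, mul_add, mul_sum, mul_assoc]

/-- Grouping by key merges addends with the same base and exponent, which may cancel, so only the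
collected forms decide the sign. -/
theorem NPE.sum_formEval {d s : ℕ} {p : NPE d} (hp : p.BoundedBy s) (c : Fin d → ℤ) (n : ℕ) :
    ((∑ x ∈ p.keys, formEval c (p.form s x) * (growth x n : ℤ) : ℤ) : ℚ)
      = s.factorial * p.eval c n := by
  have h : ∀ x, formEval c (p.form s x) * (growth x n : ℤ) =
      ((p.addends.filter fun t => t.key = x).map
      fun t => formEval c (t.coeff.form s) * (growth t.key n : ℤ)).sum := by
    intro x
    rw [NPE.form, formEval_list_sum, List.map_map, ← List.sum_map_mul_right]
    congr 1
    refine List.map_congr_left fun t ht => ?_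
    rw [List.mem_filter, decide_eq_true_iff] at ht
    rw [ht.2, Function.comp_apply]
  simp only [h]
  rw [sum_sum_filter_eq Addend.key _ _ _ fun t ht => by
    simpa [NPE.keys] using ⟨t, ht, rfl⟩]
  rw [NPE.eval, ← List.sum_map_mul_left, Int.cast_list_sum, List.map_map]
  congr 1
  refine List.map_congr_left fun t ht => ?_
  obtain ⟨-, -, h1, h2⟩ := hp.2 t ht
  rw [Function.comp_apply, Int.cast_mul, formEval_form h1 h2, Addend.eval, growth, Addend.key]
  push_cast
  simp only [ofLex_toLex]
  ring

theorem abs_list_sum_le {l : List ℤ} {K : ℤ} (h : ∀ z ∈ l, |z| ≤ K) : |l.sum| ≤ l.length * K := by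
  induction l with
  | nil => simp
  | cons z l ih =>
    rw [List.sum_cons, List.length_cons]
    push_cast
    have h1 := h z List.mem_cons_self
    have h2 := ih fun z hz => h z (List.mem_cons_of_mem _ hz)
    have h3 := abs_add_le z l.sum
    linarith

theorem NPE.abs_form_le {d s : ℕ} {p : NPE d} (hp : p.BoundedBy s) (x : ℕ ×ₗ ℕ) :
    (∀ j, |(p.form s x).1 j| ≤ ((s * s * s.factorial : ℕ) : ℤ)) ∧
      |(p.form s x).2| ≤ ((s * s * s.factorial : ℕ) : ℤ) := by
  -- One argument for all coordinates: each is an additive map, so it commutes with the sum defining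
  -- the form.
  have key : ∀ π : (Fin d → ℤ) × ℤ →+ ℤ,
      (∀ t ∈ p.addends, |π (t.coeff.form s)| ≤ ((s * s.factorial : ℕ) : ℤ)) →
      |π (p.form s x)| ≤ ((s * s * s.factorial : ℕ) : ℤ) := by
    intro π hπ
    rw [NPE.form, map_list_sum, List.map_map]
    refine (abs_list_sum_le (K := ((s * s.factorial : ℕ) : ℤ)) ?_).trans ?_
    · intro z hz
      obtain ⟨t, ht, rfl⟩ := List.mem_map.1 hz
      exact hπ t (List.mem_filter.1 ht).1
    · rw [List.length_map, mul_assoc s s]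
      exact_mod_cast Nat.mul_le_mul_right _ ((List.length_filter_le _ _).trans hp.1)
  exact ⟨fun j => key ((Pi.evalAddMonoidHom (fun _ : Fin d => ℤ) j).comp (AddMonoidHom.fst _ _))
      fun t ht => abs_scaled_le ((hp.2 t ht).2.2.1 j).1,
    key (AddMonoidHom.snd _ _) fun t ht => abs_scaled_le (hp.2 t ht).2.2.2.1⟩

theorem NPE.keys_bounded {d s : ℕ} {p : NPE d} (hp : p.BoundedBy s) :
    ∀ x ∈ p.keys, 1 ≤ (ofLex x).1 ∧ (ofLex x).1 ≤ s ∧ (ofLex x).2 ≤ s := by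
  intro x hx
  rw [NPE.keys, List.mem_toFinset, List.mem_map] at hx
  obtain ⟨t, ht, rfl⟩ := hx
  exact ⟨t.base.2, (hp.2 t ht).1, (hp.2 t ht).2.1⟩

theorem NPE.card_keys_le {d s : ℕ} {p : NPE d} (hp : p.BoundedBy s) : p.keys.card ≤ s :=
  (List.toFinset_card_le _).trans ((List.length_map _).trans_le hp.1)

/-! ### The leading coefficient criterion -/

/-- The coefficient `growth x` with the largest `x` among those that do not vanish at `c`
exists and is positive at `c`. -/
def NPE.LeadingPos {d : ℕ} (s : ℕ) (p : NPE d) (c : Fin d → ℤ) : Prop :=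
  ∃ x₀ ∈ p.keys, 0 < formEval c (p.form s x₀) ∧
    ∀ x ∈ p.keys, x₀ < x → formEval c (p.form s x) = 0

theorem NPE.eval_pos_iff {d s K n : ℕ} {p : NPE d} (hp : p.BoundedBy s) {c : Fin d → ℤ}
    (hK : ∀ x ∈ p.keys, |formEval c (p.form s x)| ≤ K)
    (hn : s * K * ((s + 1) * s) ^ (s + 1) < n) : 0 < p.eval c n ↔ p.LeadingPos s c := by
  rw [NPE.LeadingPos, ← sum_growth_pos_iff (β := fun x => formEval c (p.form s x))
    (NPE.keys_bounded hp) (NPE.card_keys_le hp) hK hn]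
  have h1 : (0 : ℚ) < s.factorial := by exact_mod_cast s.factorial_pos
  rw [← mul_pos_iff_of_pos_left h1, ← NPE.sum_formEval hp, Int.cast_pos]

/-- For a single `c`, the sum of the absolute values of the coefficients can serve as `K`; no
uniformity in `c` is needed yet. -/
theorem NPE.eventually_pos_iff {d s : ℕ} {p : NPE d} (hp : p.BoundedBy s) (c : Fin d → ℤ) :
    (∀ᶠ n in Filter.atTop, 0 < p.eval c n) ↔ p.LeadingPos s c := by
  have hK : ∀ x ∈ p.keys, |formEval c (p.form s x)|
      ≤ ((∑ x ∈ p.keys, (formEval c (p.form s x)).natAbs : ℕ) : ℤ) := by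
    intro x hx
    rw [Int.abs_eq_natAbs]
    exact_mod_cast single_le_sum (f := fun x => (formEval c (p.form s x)).natAbs)
      (fun _ _ => Nat.zero_le _) hx
  have h := Filter.eventually_gt_atTop
    (s * (∑ x ∈ p.keys, (formEval c (p.form s x)).natAbs) * ((s + 1) * s) ^ (s + 1))
  constructor
  · intro h'
    obtain ⟨n, hn, hn'⟩ := (h.and h').exists
    exact (NPE.eval_pos_iff hp hK hn).1 hn'
  · intro h'
    exact h.mono fun n hn => (NPE.eval_pos_iff hp hK hn).2 h'

theorem eventuallyPositive_iff_leadingPos {d k s : ℕ} {p : Fin k → NPE d}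
    (hp : ∀ i, (p i).BoundedBy s) :
    EventuallyPositive p ↔ ∃ c, ∀ i, (p i).LeadingPos s c := by
  refine exists_congr fun c => ?_
  simp only [← fun i => NPE.eventually_pos_iff (hp i) c, ← Filter.eventually_all]
  rw [Filter.eventually_atTop]
  exact ⟨fun ⟨n₀, h⟩ => ⟨n₀ + 1, h⟩, fun ⟨n₀, h⟩ => ⟨n₀, fun n hn => h n hn.le⟩⟩

/-! ### Explicit bounds for witness and threshold -/

/-- A bound on the coefficients of the linear constraints of an instance of size `s`. -/
def coeffBound (s : ℕ) : ℕ := s * s * s.factorial + (s + 1)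

/-- A bound on the entries of a solution of an instance of size `s`. -/
def boxBound (s : ℕ) : ℕ := elimGrowth^[2 * s] (coeffBound s)

/-- A bound on the coefficients of an instance of size `s` after substitution. -/
def valueBound (s : ℕ) : ℕ := s * (coeffBound s * boxBound s) + coeffBound s

/-- A value of `n` at which the sign of expressions of size `s` has become constant. -/
def signThreshold (s : ℕ) : ℕ := s * valueBound s * ((s + 1) * s) ^ (s + 1) + 1

theorem NPE.abs_form_le_coeffBound {d s : ℕ} {p : NPE d} (hp : p.BoundedBy s) (x : ℕ ×ₗ ℕ) :
    (∀ j, |(p.form s x).1 j| ≤ (coeffBound s : ℤ) - 1) ∧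
      |(p.form s x).2| ≤ (coeffBound s : ℤ) - 1 := by
  obtain ⟨h1, h2⟩ := NPE.abs_form_le hp x
  have h : ((s * s * s.factorial : ℕ) : ℤ) ≤ (coeffBound s : ℤ) - 1 := by
    rw [coeffBound, Nat.cast_add (s * s * s.factorial)]
    push_cast
    linarith [(Nat.cast_nonneg s : (0 : ℤ) ≤ s)]
  exact ⟨fun j => (h1 j).trans h, h2.trans h⟩

theorem NPE.abs_formEval_le {d s : ℕ} (hd : d ≤ s) {p : NPE d} (hp : p.BoundedBy s)
    (x : ℕ ×ₗ ℕ) {c : Fin d → ℤ} (hc : ∀ j, |c j| ≤ boxBound s) :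
    |formEval c (p.form s x)| ≤ valueBound s := by
  obtain ⟨h1, h2⟩ := NPE.abs_form_le_coeffBound hp x
  have h3 := abs_sum_le_card_mul fun j =>
    abs_mul_le_mul ((h1 j).trans (sub_le_self _ zero_le_one)) (hc j)
  have h4 : (d : ℤ) * ((coeffBound s : ℤ) * boxBound s) ≤ s * (coeffBound s * boxBound s) := by
    exact_mod_cast Nat.mul_le_mul_right _ hd
  refine (abs_add_le _ _).trans ?_
  rw [valueBound]
  push_cast
  linarith

/-- Fixing the leading keys of one solution turns the criterion into a linear system: over ℤ
positivity means `form - 1 ≥ 0`, and vanishing is a pair of opposite inequalities. -/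
theorem exists_small_leadingPos {d k s : ℕ} (hd : d ≤ s) {p : Fin k → NPE d}
    (hp : ∀ i, (p i).BoundedBy s) (h : ∃ c, ∀ i, (p i).LeadingPos s c) :
    ∃ c : Fin d → ℤ, (∀ j, |c j| ≤ boxBound s) ∧ ∀ i, (p i).LeadingPos s c := by
  obtain ⟨c₀, hc₀⟩ := h
  choose x₀ hx₀ hpos hzero using hc₀
  -- The summand `s + 1` in `coeffBound` ensures that the bound is at least `d` and 1, and leaves
  -- room for the shift by `-1`.
  have hM : s + 1 ≤ coeffBound s := Nat.le_add_left _ _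
  obtain ⟨c, hc, hsol⟩ := exists_small_solution d (coeffBound s) (by omega) (by omega)
    {r | ∃ i, r = (p i).form s (x₀ i) + (0, -1) ∨ ∃ x ∈ (p i).keys, x₀ i < x ∧
      (r = (p i).form s x ∨ r = -(p i).form s x)} (by
        rintro r ⟨i, rfl | ⟨x, -, -, rfl | rfl⟩⟩
        · obtain ⟨h1, h2⟩ := NPE.abs_form_le_coeffBound (hp i) (x₀ i)
          refine ⟨fun j => ?_, ?_⟩
          · simpa using (h1 j).trans (sub_le_self _ zero_le_one)
          · refine (abs_add_le _ _).trans ?_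
            simpa using add_le_add_left h2 1
        · obtain ⟨h1, h2⟩ := NPE.abs_form_le_coeffBound (hp i) x
          exact ⟨fun j => (h1 j).trans (sub_le_self _ zero_le_one),
            h2.trans (sub_le_self _ zero_le_one)⟩
        · obtain ⟨h1, h2⟩ := NPE.abs_form_le_coeffBound (hp i) x
          simp only [Prod.fst_neg, Prod.snd_neg, Pi.neg_apply, abs_neg]
          exact ⟨fun j => (h1 j).trans (sub_le_self _ zero_le_one),
            h2.trans (sub_le_self _ zero_le_one)⟩)
    ⟨c₀, by
      rintro r ⟨i, rfl | ⟨x, hx, hlt, rfl | rfl⟩⟩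
      · have := hpos i
        rw [formEval_add]
        simp only [formEval, Pi.zero_apply, zero_mul, sum_const_zero] at this ⊢
        omega
      · exact (hzero i x hx hlt).ge
      · rw [formEval_neg, hzero i x hx hlt, neg_zero]⟩
  refine ⟨c, fun j => (hc j).trans ?_, fun i => ⟨x₀ i, hx₀ i, ?_, fun x hx hlt => ?_⟩⟩
  · exact_mod_cast Function.monotone_iterate_of_id_le id_le_elimGrowth
      (Nat.mul_le_mul_left 2 hd) (coeffBound s)
  · have := hsol _ ⟨i, Or.inl rfl⟩
    rw [formEval_add] at this
    simp only [formEval, Pi.zero_apply, zero_mul, sum_const_zero] at this ⊢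
    omega
  · have h1 := hsol _ ⟨i, Or.inr ⟨x, hx, hlt, Or.inl rfl⟩⟩
    have h2 := hsol _ ⟨i, Or.inr ⟨x, hx, hlt, Or.inr rfl⟩⟩
    rw [formEval_neg] at h2
    linarith

/-- Eventual positiveness is witnessed within explicit bounds. -/
theorem eventuallyPositive_iff_bounded {d k s : ℕ} (hd : d ≤ s) {p : Fin k → NPE d}
    (hp : ∀ i, (p i).BoundedBy s) :
    EventuallyPositive p ↔ ∃ c : Fin d → ℤ, (∀ j, |c j| ≤ boxBound s) ∧
      ∀ i, 0 < (p i).eval c (signThreshold s) := by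
  have key : ∀ c : Fin d → ℤ, (∀ j, |c j| ≤ boxBound s) → ∀ i,
      (0 < (p i).eval c (signThreshold s) ↔ (p i).LeadingPos s c) := fun c hc i =>
    NPE.eval_pos_iff (hp i) (fun x _ => NPE.abs_formEval_le hd (hp i) x hc) (Nat.lt_succ_self _)
  rw [eventuallyPositive_iff_leadingPos hp]
  constructor
  · intro h
    obtain ⟨c, hc, h⟩ := exists_small_leadingPos hd hp h
    exact ⟨c, hc, fun i => (key c hc i).2 (h i)⟩
  · rintro ⟨c, hc, h⟩
    exact ⟨c, fun i => (key c hc i).1 (h i)⟩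

end PolyExp

/-! ### Primitive recursive integer arithmetic and bounds -/

namespace PolyExp

open Encodable

theorem encode_natCast (n : ℕ) : encode (n : ℤ) = 2 * n := rfl

theorem encode_negSucc (n : ℕ) : encode (Int.negSucc n) = 2 * n + 1 := rfl

theorem primrec_toNat : Primrec Int.toNat := by
  refine (Primrec.cond (Primrec.nat_bodd.comp Primrec.encode) (Primrec.const 0)
    (Primrec.nat_div2.comp Primrec.encode)).of_eq fun z => ?_
  cases z with
  | ofNat n => simp [encode_natCast]
  | negSucc n => simp [encode_negSucc]

theorem primrec_toNat_neg : Primrec fun z : ℤ => (-z).toNat := by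
  refine (Primrec.cond (Primrec.nat_bodd.comp Primrec.encode)
    (Primrec.succ.comp (Primrec.nat_div2.comp Primrec.encode)) (Primrec.const 0)).of_eq fun z => ?_
  cases z with
  | ofNat n => simp [encode_natCast]
  | negSucc n => simp [encode_negSucc]

theorem primrec_natCast : Primrec fun n : ℕ => (n : ℤ) :=
  Primrec.encode_iff.1 (Primrec.nat_double.of_eq fun n => (encode_natCast n).symm)

theorem primrec_negSucc : Primrec Int.negSucc :=
  Primrec.encode_iff.1 (Primrec.nat_double_succ.of_eq fun n => (encode_negSucc n).symm)

/-- Integers are differences of their positive and negative parts, so this reduces integer addition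
and multiplication to natural numbers. -/
theorem primrec_natCast_sub : Primrec₂ fun m n : ℕ => (m : ℤ) - n := by
  refine (Primrec.ite (Primrec.nat_le.comp Primrec.snd Primrec.fst)
    (primrec_natCast.comp (Primrec.nat_sub.comp Primrec.fst Primrec.snd))
    (primrec_negSucc.comp (Primrec.pred.comp (Primrec.nat_sub.comp Primrec.snd Primrec.fst)))).of_eq
    fun p => ?_
  show _ = (p.1 : ℤ) - p.2
  split_ifs with h
  · omega
  · rw [Int.negSucc_eq, Nat.pred_eq_sub_one]
    omega

theorem primrec_int_add : Primrec₂ ((· + ·) : ℤ → ℤ → ℤ) := by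
  refine (primrec_natCast_sub.comp
    (Primrec.nat_add.comp (primrec_toNat.comp Primrec.fst) (primrec_toNat.comp Primrec.snd))
    (Primrec.nat_add.comp (primrec_toNat_neg.comp Primrec.fst)
      (primrec_toNat_neg.comp Primrec.snd))).of_eq fun p => ?_
  push_cast
  omega

theorem primrec_int_mul : Primrec₂ ((· * ·) : ℤ → ℤ → ℤ) := by
  have h1 := primrec_toNat.comp (Primrec.fst (α := ℤ) (β := ℤ))
  have h2 := primrec_toNat.comp (Primrec.snd (α := ℤ) (β := ℤ))
  have h3 := primrec_toNat_neg.comp (Primrec.fst (α := ℤ) (β := ℤ))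
  have h4 := primrec_toNat_neg.comp (Primrec.snd (α := ℤ) (β := ℤ))
  refine (primrec_natCast_sub.comp
    (Primrec.nat_add.comp (Primrec.nat_mul.comp h1 h2) (Primrec.nat_mul.comp h3 h4))
    (Primrec.nat_add.comp (Primrec.nat_mul.comp h1 h4) (Primrec.nat_mul.comp h3 h2))).of_eq
    fun p => ?_
  have e1 := Int.toNat_sub_toNat_neg p.1
  have e2 := Int.toNat_sub_toNat_neg p.2
  conv_rhs => rw [← e1, ← e2]
  push_cast
  ring

theorem primrec_int_pos : PrimrecPred fun z : ℤ => 0 < z :=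
  ((Primrec.nat_lt.comp (Primrec.const 0) primrec_toNat)).of_eq fun z => by omega

theorem primrec_nat_pow : Primrec₂ ((· ^ ·) : ℕ → ℕ → ℕ) :=
  Primrec₂.unpaired'.1 Nat.Primrec.pow

theorem primrec_factorial : Primrec Nat.factorial := by
  refine (Primrec.nat_rec₁ (f := fun n r => (n + 1) * r) 1 (Primrec.nat_mul.comp
    (Primrec.succ.comp Primrec.fst) Primrec.snd)).of_eq fun n => ?_
  induction n with
  | zero => rfl
  | succ n ih => rw [Nat.factorial_succ, ← ih]

theorem primrec_int_list_sum {α β : Type*} [Primcodable α] [Primcodable β] {f : α → List β}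
    {g : α → β → ℤ} (hf : Primrec f) (hg : Primrec₂ g) :
    Primrec fun a => ((f a).map (g a)).sum := by
  refine (Primrec.list_foldr (Primrec.list_map hf hg) (Primrec.const (0 : ℤ))
    (h := fun _ p => p.1 + p.2) (primrec_int_add.comp (Primrec.fst.comp Primrec.snd)
      (Primrec.snd.comp Primrec.snd))).of_eq fun a => ?_
  rw [List.sum_eq_foldr]

theorem primrec_elimGrowth : Primrec elimGrowth :=
  Primrec.nat_mul.comp (Primrec.const 6) (primrec_nat_pow.comp Primrec.id (Primrec.const 4))

theorem primrec_coeffBound : Primrec coeffBound :=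
  Primrec.nat_add.comp (Primrec.nat_mul.comp (Primrec.nat_mul.comp Primrec.id Primrec.id)
    primrec_factorial) Primrec.succ

theorem primrec_boxBound : Primrec boxBound :=
  Primrec.nat_iterate Primrec.nat_double primrec_coeffBound (primrec_elimGrowth.comp Primrec.snd)

theorem primrec_valueBound : Primrec valueBound :=
  Primrec.nat_add.comp (Primrec.nat_mul.comp Primrec.id
    (Primrec.nat_mul.comp primrec_coeffBound primrec_boxBound)) primrec_coeffBound

theorem primrec_signThreshold : Primrec signThreshold :=
  Primrec.succ.comp (Primrec.nat_mul.comp (Primrec.nat_mul.comp Primrec.id primrec_valueBound)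
    (primrec_nat_pow.comp (Primrec.nat_mul.comp Primrec.succ Primrec.id) Primrec.succ))

theorem primrec_scaled : Primrec₂ scaled :=
  primrec_int_mul.comp (Primrec.fst.comp Primrec.snd) (primrec_natCast.comp
    (Primrec.nat_div.comp (primrec_factorial.comp Primrec.fst) (Primrec.snd.comp Primrec.snd)))

/-! ### Enumeration of the box and evaluation of codes -/

/-- The `i`-th digit of `m` in base `2 * B + 1`, shifted to lie between `-B` and `B`. -/
def digit (B m i : ℕ) : ℤ := ((m / (2 * B + 1) ^ i % (2 * B + 1) : ℕ) : ℤ) - B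

theorem primrec_digit : Primrec fun q : (ℕ × ℕ) × ℕ => digit q.1.1 q.1.2 q.2 := by
  have hB : Primrec fun q : (ℕ × ℕ) × ℕ => q.1.1 := Primrec.fst.comp Primrec.fst
  have hW : Primrec fun q : (ℕ × ℕ) × ℕ => 2 * q.1.1 + 1 := Primrec.nat_double_succ.comp hB
  exact primrec_natCast_sub.comp (Primrec.nat_mod.comp (Primrec.nat_div.comp
    (Primrec.snd.comp Primrec.fst) (primrec_nat_pow.comp hW Primrec.snd)) hW) hB

/-- Shifting the entries by `B` makes them digits in base `2 * B + 1`, so one number runs through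
the whole box. -/
theorem exists_digit_eq {d B : ℕ} (c : Fin d → ℤ) (hc : ∀ j, |c j| ≤ B) :
    ∃ m < (2 * B + 1) ^ d, ∀ j : Fin d, digit B m j = c j := by
  have h : ∀ j, (c j + B).toNat < 2 * B + 1 := fun j => by
    have := abs_le.1 (hc j)
    omega
  let m := finFunctionFinEquiv fun j => (⟨(c j + B).toNat, h j⟩ : Fin (2 * B + 1))
  refine ⟨m, m.2, fun j => ?_⟩
  have h1 := congrArg (fun f => (f j : ℕ)) (finFunctionFinEquiv.symm_apply_apply
    fun j => (⟨(c j + B).toNat, h j⟩ : Fin (2 * B + 1)))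
  have h2 := abs_le.1 (hc j)
  have h3 : (m : ℕ) / (2 * B + 1) ^ (j : ℕ) % (2 * B + 1) = (c j + B).toNat := h1
  rw [digit, h3]
  omega

theorem abs_digit_le (B m i : ℕ) : |digit B m i| ≤ B := by
  have := Nat.mod_lt (m / (2 * B + 1) ^ i) (show 0 < 2 * B + 1 by omega)
  rw [digit, abs_le]
  omega

/-- The value of a coded affine expression, scaled by `s!`. -/
def affineVal (s : ℕ) (c : ℕ → ℤ) (α : AffineCode) : ℤ :=
  -- The default `(0, 0)` is never read, as `i` is below the length.
  ((List.range α.1.length).map fun i => scaled s (α.1.getD i (0, 0)) * c i).sum + scaled s α.2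

/-- The value of a coded addend, scaled by `s!`. -/
def addendVal (s : ℕ) (c : ℕ → ℤ) (n : ℕ) (t : AddendCode) : ℤ :=
  affineVal s c t.1 * ((n ^ t.2.1 * t.2.2 ^ n : ℕ) : ℤ)

/-- The value of a coded poly-exponential expression, scaled by `s!`. -/
def npeVal (s : ℕ) (c : ℕ → ℤ) (n : ℕ) (p : NPECode) : ℤ := (p.map (addendVal s c n)).sum

/-- Some vector in the box of an instance of size `s` makes all its expressions positive at the
threshold. -/
def BoundedWitness (I : InstanceCode) (s : ℕ) : Prop :=
  ∃ m < (2 * boxBound s + 1) ^ I.1, ∀ p ∈ I.2,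
    0 < npeVal s (digit (boxBound s) m) (signThreshold s) p

section

variable {γ : Type*} [Primcodable γ] {s B m n : γ → ℕ}

theorem primrec_affineVal (hs : Primrec s) (hB : Primrec B) (hm : Primrec m) {α : γ → AffineCode}
    (hα : Primrec α) : Primrec fun q => affineVal (s q) (digit (B q) (m q)) (α q) := by
  refine primrec_int_add.comp (primrec_int_list_sum (Primrec.list_range.comp
    (Primrec.list_length.comp (Primrec.fst.comp hα))) ?_)
    (primrec_scaled.comp hs (Primrec.snd.comp hα))
  exact primrec_int_mul.comp
    (primrec_scaled.comp (hs.comp Primrec.fst) ((Primrec.list_getD (0, 0)).comp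
      (Primrec.fst.comp (hα.comp Primrec.fst)) Primrec.snd))
    (primrec_digit.comp (((hB.comp Primrec.fst).pair (hm.comp Primrec.fst)).pair Primrec.snd))

theorem primrec_addendVal (hs : Primrec s) (hB : Primrec B) (hm : Primrec m) (hn : Primrec n)
    {t : γ → AddendCode} (ht : Primrec t) :
    Primrec fun q => addendVal (s q) (digit (B q) (m q)) (n q) (t q) :=
  primrec_int_mul.comp (primrec_affineVal hs hB hm (Primrec.fst.comp ht))
    (primrec_natCast.comp (Primrec.nat_mul.comp
      (primrec_nat_pow.comp hn (Primrec.fst.comp (Primrec.snd.comp ht)))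
      (primrec_nat_pow.comp (Primrec.snd.comp (Primrec.snd.comp ht)) hn)))

theorem primrec_npeVal (hs : Primrec s) (hB : Primrec B) (hm : Primrec m) (hn : Primrec n)
    {p : γ → NPECode} (hp : Primrec p) :
    Primrec fun q => npeVal (s q) (digit (B q) (m q)) (n q) (p q) :=
  primrec_int_list_sum hp (primrec_addendVal (hs.comp Primrec.fst) (hB.comp Primrec.fst)
    (hm.comp Primrec.fst) (hn.comp Primrec.fst) Primrec.snd)

end

theorem primrecRel_exists_lt_forall_mem {α β : Type*} [Primcodable α] [Primcodable β]
    {R : α → β × ℕ → Prop} (hR : PrimrecRel R) {γ : Type*} [Primcodable γ] {f : γ → ℕ}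
    {l : γ → List α} {g : γ → β} (hf : Primrec f) (hl : Primrec l) (hg : Primrec g) :
    PrimrecPred fun q => ∃ m < f q, ∀ a ∈ l q, R a (g q, m) := by
  have h : PrimrecRel fun (m : ℕ) (q : γ) => ∀ a ∈ l q, R a (g q, m) :=
    hR.forall_mem_list.comp (hl.comp Primrec.snd) ((hg.comp Primrec.snd).pair Primrec.fst)
  exact (h.exists_mem_list.comp (Primrec.list_range.comp hf) Primrec.id).of_eq fun q => by simp

theorem primrec_boundedWitness :
    PrimrecPred fun q : InstanceCode × ℕ => BoundedWitness q.1 q.2 := by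
  have hs : Primrec fun x : NPECode × (ℕ × ℕ) => x.2.1 := Primrec.fst.comp Primrec.snd
  have h : PrimrecRel fun (p : NPECode) (q : ℕ × ℕ) =>
      0 < npeVal q.1 (digit (boxBound q.1) q.2) (signThreshold q.1) p :=
    PrimrecPred.comp primrec_int_pos (primrec_npeVal hs (primrec_boxBound.comp hs)
      (Primrec.snd.comp Primrec.snd) (primrec_signThreshold.comp hs) Primrec.fst)
  have hf : Primrec fun q : InstanceCode × ℕ => (2 * boxBound q.2 + 1) ^ q.1.1 :=
    primrec_nat_pow.comp (Primrec.nat_double_succ.comp (primrec_boxBound.comp Primrec.snd))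
      (Primrec.fst.comp Primrec.fst)
  exact primrecRel_exists_lt_forall_mem h hf (Primrec.snd.comp Primrec.fst) Primrec.snd

/-! ### Correctness of the search on codes -/

theorem affineVal_code {d s : ℕ} (α : AffineExpr d) (c : ℕ → ℤ) :
    affineVal s c α.code = formEval (fun j : Fin d => c j) (α.form s) := by
  rw [affineVal, formEval, AffineExpr.code, AffineExpr.form, List.length_ofFn]
  congr 1
  trans ∑ i ∈ Finset.range d, scaled s ((List.ofFn fun i => ratCode (α.coeff i)).getD i (0, 0)) * c i
  · rfl
  · rw [Finset.sum_range]
    simp [List.getD_eq_getElem?_getD]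

theorem npeVal_code {d s : ℕ} {p : NPE d} (hp : p.BoundedBy s) (c : ℕ → ℤ) (n : ℕ) :
    (npeVal s c n p.code : ℚ) = s.factorial * p.eval (fun j => c j) n := by
  rw [npeVal, NPE.code, NPE.eval, List.map_map, ← List.sum_map_mul_left, Int.cast_list_sum,
    List.map_map]
  congr 1
  refine List.map_congr_left fun t ht => ?_
  obtain ⟨-, -, h1, h2⟩ := hp.2 t ht
  simp only [Function.comp_apply, addendVal, Addend.code, affineVal_code, Int.cast_mul,
    formEval_form h1 h2, Addend.eval]
  push_cast
  ring

theorem encode_le_encode_pair {α β : Type*} [Encodable α] [Encodable β] (a : α) (b : β) :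
    encode a ≤ encode (a, b) ∧ encode b ≤ encode (a, b) :=
  ⟨Nat.left_le_pair _ _, Nat.right_le_pair _ _⟩

/-- Pairing dominates both components, so the code number of an instance bounds every number in it
and the lengths of its lists. -/
theorem encode_le_encode_of_mem {α : Type*} [Encodable α] {a : α} {l : List α} (h : a ∈ l) :
    encode a ≤ encode l := by
  induction l with
  | nil => simp at h
  | cons b l ih =>
    rw [encode_list_cons]
    rcases List.mem_cons.1 h with rfl | h
    · exact (Nat.left_le_pair _ _).trans (Nat.le_succ _)
    · exact (ih h).trans ((Nat.right_le_pair _ _).trans (Nat.le_succ _))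

theorem ratBoundedBy_of_encode_le {s : ℕ} {q : ℚ} (h : encode (ratCode q) ≤ s) :
    RatBoundedBy s q := by
  obtain ⟨h1, h2⟩ := encode_le_encode_pair q.num q.den
  have h3 := h1.trans h
  refine ⟨?_, h2.trans h⟩
  generalize q.num = z at h3 ⊢
  cases z with
  | ofNat n =>
    rw [Int.ofNat_eq_natCast, encode_natCast] at h3
    rw [Int.ofNat_eq_natCast, Nat.abs_cast]
    omega
  | negSucc n =>
    rw [encode_negSucc] at h3
    rw [Int.negSucc_eq, abs_neg, abs_of_nonneg (by positivity)]
    omega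

theorem boundedBy_of_encode_le {d s : ℕ} {p : NPE d} (h : encode p.code ≤ s) : p.BoundedBy s := by
  refine ⟨?_, fun t ht => ?_⟩
  · have := (length_le_encode p.code).trans h
    rwa [NPE.code, List.length_map] at this
  · have h1 : encode t.code ≤ s :=
      (encode_le_encode_of_mem (List.mem_map_of_mem (f := Addend.code) ht)).trans h
    obtain ⟨h2, h3⟩ := encode_le_encode_pair t.coeff.code (t.exp, (t.base : ℕ))
    obtain ⟨h4, h5⟩ := encode_le_encode_pair t.exp (t.base : ℕ)
    obtain ⟨h6, h7⟩ := encode_le_encode_pair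
      (List.ofFn fun i => ratCode (t.coeff.coeff i)) (ratCode t.coeff.const)
    have h8 := h2.trans h1
    have h9 := h3.trans h1
    refine ⟨h5.trans h9, h4.trans h9, fun i => ratBoundedBy_of_encode_le ?_,
      ratBoundedBy_of_encode_le (h7.trans h8)⟩
    exact (encode_le_encode_of_mem (List.mem_ofFn.2 ⟨i, rfl⟩)).trans (h6.trans h8)

theorem boundedWitness_iff {d k : ℕ} (p : Fin k → NPE d) :
    BoundedWitness (instanceCode p) (encode (instanceCode p)) ↔ EventuallyPositive p := by
  obtain ⟨hd, hl⟩ := encode_le_encode_pair d (List.ofFn fun i => (p i).code)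
  have hp : ∀ i, (p i).BoundedBy (encode (instanceCode p)) := fun i =>
    boundedBy_of_encode_le ((encode_le_encode_of_mem (List.mem_ofFn.2 ⟨i, rfl⟩)).trans hl)
  generalize hs : encode (instanceCode p) = s at hp
  have hds : d ≤ s := hs ▸ hd
  have hf : (0 : ℚ) < s.factorial := by exact_mod_cast s.factorial_pos
  have key : ∀ (c : ℕ → ℤ) i, 0 < npeVal s c (signThreshold s) (p i).code ↔
      0 < (p i).eval (fun j => c j) (signThreshold s) := fun c i => by
    rw [← mul_pos_iff_of_pos_left hf, ← npeVal_code (hp i), Int.cast_pos]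
  rw [eventuallyPositive_iff_bounded hds hp]
  simp only [BoundedWitness, instanceCode, List.forall_mem_ofFn_iff, key]
  constructor
  -- The range of `m` is irrelevant here: digits always lie in the box.
  · rintro ⟨m, -, h⟩
    exact ⟨_, fun j => abs_digit_le _ m j, h⟩
  · rintro ⟨c, hc, h⟩
    obtain ⟨m, hm, hmc⟩ := exists_digit_eq c hc
    exact ⟨m, hm, by simpa only [hmc] using h⟩

end PolyExp

theorem mainTheorem3 :
    ∃ decider : PolyExp.InstanceCode → Bool, Computable decider ∧
      ∀ (d k : ℕ) (p : Fin k → PolyExp.NPE d),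
        decider (PolyExp.instanceCode p) = true ↔ PolyExp.EventuallyPositive p := by
  have h : PrimrecPred fun I : PolyExp.InstanceCode =>
      PolyExp.BoundedWitness I (Encodable.encode I) :=
    PolyExp.primrec_boundedWitness.comp (Primrec.id.pair Primrec.encode)
  obtain ⟨_, h⟩ := h
  refine ⟨_, h.to_comp, fun d k p => ?_⟩
  rw [decide_eq_true_iff]
  exact PolyExp.boundedWitness_iff p
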